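/- **Setting.** Let $T\ge 0$, let $X\subset\mathbb R^n$ be compact, let $p$ be a real function continuous on $X$, let $r\in\mathbb R$, and let $\mu_0$ be a finite nonnegative Borel measure on $\mathbb R^n$ supported in $X$. For a set $S$, let $\mathcal M_+(S)$ be the set of finite nonnegative Borel measures supported in $S$, and write $\langle h,\mu\rangle=\int h\,d\mu$ and $\mathbb L^3=\{(y,s)\in\mathbb R^3\times\mathbb R: s\ge\|y\|_2\}$. Let $\mathcal L$, with domain $\mathcal C$ (a vector space of test functions $v(t,x)$ on $\mathbb R\times\mathbb R^n$), be the generator of a stochastic process whose trajectories are stopped on leaving $X$, that is, one of the following: * an Itô SDE $dx=f\,dt+g\,dW$ with $f$ and $g=(g_1,\dots,g_m)$ continuous on $[0,T]\times X$: $\mathcal C=C^{1,2}$ and $\mathcal Lv=\partial_tv+f\cdot\nabla_xv+\tfrac12\sum_j g_j^{\top}(\nabla^2_{xx}v)g_j$; * a discrete-time process $x[t+\Delta t]=f(t,x[t],\lambda[t])$, $\lambda[t]\sim\xi$, with $\Delta t>0$, $\xi$ a probability measure, $f(t,x,\cdot)$ measurable and with values $\xi$-a.s. in $X$ for $(t,x)\in[0,T]\times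 X$: $\mathcal C$ is the space of continuous functions and $\mathcal Lv(t,x)=\big(\int v(t+\Delta t,f(t,x,\lambda))\,d\xi(\lambda)-v(t,x)\big)/\Delta t$, where $\mathcal Lv$ is assumed continuous on $[0,T]\times X$ for $v\in\mathcal C$; * a continuous-time Markov process on $\mathbb R^n$: for $v\in\mathcal C$ and $(t,x)\in[0,T]\times X$, $v(t+h,x(t+h))$ given $x(t)=x$ is integrable for small $h>0$ and $\mathcal Lv(t,x)=\lim_{h\downarrow0}\big(\mathbb E[v(t+h,x(t+h))\mid x(t)=x]-v(t,x)\big)/h$; here $v$ and $\mathcal Lv$ are continuous on $[0,T]\times X$ for $v\in\mathcal C$, and $\mathcal C$ contains the functions $1$ and $t$. The *tail-bound measure SOCP* is $$p^*_r=\sup\ rc+\langle p,\mu_\tau\rangle\quad\text{over }\mu,\mu_\tau\in\mathcal M_+([0,T]\times X),\ c\in\mathbb R,$$ subject to $\langle v,\mu_\tau\rangle=\langle v(0,\cdot),\mu_0\rangle+\langle\mathcal Lv,\mu\rangle$ for all $v\in\mathcal C$ and $\big([1-\langle p^2,\mu_\tau\rangle,\,2c,\,2\langle p,\mu_\tau\rangle],\,1+\langle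 p^2,\mu_\tau\rangle\big)\in\mathbb L^3$. It has the same value as its conic form: maximize $\tfrac r2z_2+\langle p,\mu_\tau\rangle$ over $\mu,\mu_\tau\in\mathcal M_+([0,T]\times X)$ and $([z_1,z_2,z_3],z_4)\in\mathbb L^3$, subject to $z_1+\langle p^2,\mu_\tau\rangle=1$, $z_3-2\langle p,\mu_\tau\rangle=0$, $z_1+z_4=2$ and the same equations for all $v\in\mathcal C$. Suprema and infima are taken in $[-\infty,\infty]$. **Theorem.** (1) The Lagrangian dual of the conic form, with multipliers $u\in\mathbb R^3$ for the three scalar equations and $v\in\mathcal C$ for the last family of equations, is the program $$d^*_r=\inf\ u_1+2u_3+\int v(0,x_0)\,d\mu_0(x_0)\quad\text{over }u\in\mathbb R^3,\ v\in\mathcal C,$$ subject to, for all $(t,x)\in[0,T]\times X$, $\mathcal Lv(t,x)\le0$ and $v(t,x)+u_1p(x)^2-2u_2p(x)\ge p(x)$, and $([u_1+u_3,-r/2,u_2],u_3)\in\mathbb L^3$. That is, the supremum of the Lagrangian over the primal cones equals the above cost if $(v,u)$ satisfies these constraints and $+\infty$ otherwise, so that the infimum over $(v,u)$ of that supremum is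 $d^*_r$. (2) Weak duality $d^*_r\ge p^*_r$ holds. (3) If $\mu_0$ is a probability measure, strong duality $d^*_r=p^*_r$ holds. -/

import Mathlib

open MeasureTheory ProbabilityTheory Filter Topology Set
open scoped NNReal ENNReal

universe u

noncomputable section

namespace ChancePeak

/-- The state space `ℝⁿ` with its Euclidean norm. -/
abbrev State (n : ℕ) : Type := EuclideanSpace ℝ (Fin n)

/-- Test functions `v(t, x)`. They are functions on all of `ℝ × ℝⁿ`; the programs below only see
the restrictions of `v` and of `L v` to `[0, T] × X`. -/
abbrev TestFun (n : ℕ) : Type := ℝ × State n → ℝ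

/-- The set `[0, T] × X`. -/
def cyl {n : ℕ} (T : ℝ) (X : Set (State n)) : Set (ℝ × State n) := Icc 0 T ×ˢ X

/-- The second-order cone `{(y, s) ∈ ℝᵏ × ℝ : s ≥ ‖y‖₂}`. -/
def secondOrderCone (k : ℕ) : Set (EuclideanSpace ℝ (Fin k) × ℝ) := {w | ‖w.1‖ ≤ w.2}

/-- `μ` is a (finite) nonnegative Borel measure supported in the set `S`. -/
def IsMeasureOn {α : Type*} [MeasurableSpace α] (S : Set α) (μ : Measure α) : Prop :=
  IsFiniteMeasure μ ∧ μ Sᶜ = 0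

/-! ### Generators of stochastic processes -/

/-- `v` is of class `C^{1,2}`: once continuously differentiable in time, twice in space. -/
structure IsC12 {n : ℕ} (v : TestFun n) : Prop where
  continuous : Continuous v
  diff_time : ∀ t x, DifferentiableAt ℝ (fun s => v (s, x)) t
  diff_space : ∀ t, ContDiff ℝ 2 (fun y => v (t, y))
  cont_time : Continuous fun z : ℝ × State n => deriv (fun s => v (s, z.2)) z.1
  cont_space : Continuous fun z : ℝ × State n => fderiv ℝ (fun y => v (z.1, y)) z.2
  cont_space_two : Continuous fun z : ℝ × State n =>
    fderiv ℝ (fderiv ℝ (fun y => v (z.1, y))) z.2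

lemma IsC12.fderiv_diff {n : ℕ} {v : TestFun n} (hv : IsC12 v) (t : ℝ) :
    Differentiable ℝ (fderiv ℝ (fun y => v (t, y))) :=
  ((hv.diff_space t).fderiv_right (m := 1) (by norm_num)).differentiable (by norm_num)

lemma IsC12.add {n : ℕ} {v w : TestFun n} (hv : IsC12 v) (hw : IsC12 w) : IsC12 (v + w) := by
  have e1 : ∀ t, fderiv ℝ (fun y => (v + w) (t, y)) =
      fun x => fderiv ℝ (fun y => v (t, y)) x + fderiv ℝ (fun y => w (t, y)) x := by
    intro t
    funext x
    exact fderiv_fun_add ((hv.diff_space t).differentiable (by norm_num) x)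
      ((hw.diff_space t).differentiable (by norm_num) x)
  refine ⟨hv.continuous.add hw.continuous, fun t x => (hv.diff_time t x).add (hw.diff_time t x),
    fun t => (hv.diff_space t).add (hw.diff_space t), ?_, ?_, ?_⟩
  · refine (hv.cont_time.add hw.cont_time).congr fun z => ?_
    exact (deriv_fun_add (hv.diff_time z.1 z.2) (hw.diff_time z.1 z.2)).symm
  · refine (hv.cont_space.add hw.cont_space).congr fun z => ?_
    rw [e1]
    rfl
  · refine (hv.cont_space_two.add hw.cont_space_two).congr fun z => ?_
    rw [e1]
    exact (fderiv_fun_add (hv.fderiv_diff z.1 z.2) (hw.fderiv_diff z.1 z.2)).symm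

lemma IsC12.smul {n : ℕ} {v : TestFun n} (c : ℝ) (hv : IsC12 v) : IsC12 (c • v) := by
  have e1 : ∀ t, fderiv ℝ (fun y => (c • v) (t, y)) =
      fun x => c • fderiv ℝ (fun y => v (t, y)) x := by
    intro t
    funext x
    exact fderiv_fun_const_smul ((hv.diff_space t).differentiable (by norm_num) x) c
  refine ⟨hv.continuous.const_smul c, fun t x => (hv.diff_time t x).const_smul c,
    fun t => (hv.diff_space t).const_smul c, ?_, ?_, ?_⟩
  · refine (hv.cont_time.const_smul c).congr fun z => ?_
    exact (deriv_fun_const_smul c (hv.diff_time z.1 z.2)).symm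
  · refine (hv.cont_space.const_smul c).congr fun z => ?_
    rw [e1]
    rfl
  · refine (hv.cont_space_two.const_smul c).congr fun z => ?_
    rw [e1]
    exact (fderiv_fun_const_smul (hv.fderiv_diff z.1 z.2) c).symm

lemma IsC12.zero {n : ℕ} : IsC12 (0 : TestFun n) := by
  refine ⟨continuous_const, fun t x => differentiableAt_const _, fun t => contDiff_const,
    ?_, ?_, ?_⟩ <;> simp [continuous_const]

/-- The space of `C^{1,2}` test functions, the domain of the generator of an Itô SDE. -/
def c12 (n : ℕ) : Submodule ℝ (TestFun n) where
  carrier := {v | IsC12 v}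
  add_mem' := fun hv hw => hv.add hw
  zero_mem' := IsC12.zero
  smul_mem' := fun c _ hv => hv.smul c

/-- The space of continuous test functions, the domain of a discrete-time generator. -/
def contTest (n : ℕ) : Submodule ℝ (TestFun n) where
  carrier := {v | Continuous v}
  add_mem' := fun hv hw => hv.add hw
  zero_mem' := continuous_const
  smul_mem' := fun c _ hv => hv.const_smul c

/-- The generator of the Itô SDE `dx = f(t, x) dt + g(t, x) dW`, where `g(t, x)` is the matrix with
columns `g(t, x)_1, …, g(t, x)_m` and `W` is an `m`-dimensional Wiener process:
`L v = ∂ₜ v + f ⋅ ∇ₓ v + (1/2) tr (gᵀ (∇²ₓₓ v) g)`. -/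
def itoGenerator {n m : ℕ} (f : ℝ × State n → State n) (g : ℝ × State n → Fin m → State n)
    (v : TestFun n) : TestFun n := fun z =>
  deriv (fun s => v (s, z.2)) z.1 + fderiv ℝ (fun y => v (z.1, y)) z.2 (f z)
    + (1 / 2) * ∑ j, fderiv ℝ (fderiv ℝ (fun y => v (z.1, y))) z.2 (g z j) (g z j)

/-- The generator of the discrete-time process `x[t + δ] = f(t, x[t], l[t])`, `l[t] ∼ ξ`:
`L v (t, x) = (∫ v(t + δ, f(t, x, l)) dξ(l) - v(t, x)) / δ`. -/
def discreteGenerator {n : ℕ} {Lam : Type u} [MeasurableSpace Lam] (ξ : Measure Lam) (δ : ℝ)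
    (f : ℝ × State n → Lam → State n) (v : TestFun n) : TestFun n := fun z =>
  ((∫ l, v (z.1 + δ, f z l) ∂ξ) - v z) / δ

/-- The transition kernels of a (possibly time-inhomogeneous) continuous-time Markov process on
`ℝⁿ`: `kernel t h x` is the law of `x(t + h)` given `x(t) = x`. -/
structure MarkovProcess (n : ℕ) where
  kernel : ℝ → ℝ≥0 → Kernel (State n) (State n)
  markov : ∀ t h, IsMarkovKernel (kernel t h)
  kernel_zero : ∀ t, kernel t 0 = Kernel.id
  chapman_kolmogorov : ∀ (t : ℝ) (h k : ℝ≥0),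
    kernel (t + (h : ℝ)) k ∘ₖ kernel t h = kernel t (h + k)

/-- `L`, with domain `C`, is the generator on `[0, T] × X` of a stochastic process:

* `ito`: an Itô SDE with continuous coefficients, with domain `C^{1,2}`;
* `discrete`: a discrete-time process in `X`, with domain the continuous functions, which `L` maps
  to functions continuous on `[0, T] × X`;
* `markov`: any continuous-time Markov process, with
  `L v (t, x) = lim_{h ↓ 0} (𝔼[v(t + h, x(t + h)) | x(t) = x] - v(t, x)) / h` for `v` in the
  domain `C`, a space of functions which are continuous on `[0, T] × X` together with `L v`, and
  which contains the functions `1` and `t`. -/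
inductive IsGenerator {n : ℕ} (T : ℝ) (X : Set (State n)) :
    Submodule ℝ (TestFun n) → (TestFun n → TestFun n) → Prop
  | ito {m : ℕ} (f : ℝ × State n → State n) (g : ℝ × State n → Fin m → State n)
      (hf : ContinuousOn f (cyl T X)) (hg : ContinuousOn g (cyl T X)) :
      IsGenerator T X (c12 n) (itoGenerator f g)
  | discrete {Lam : Type u} [MeasurableSpace Lam] (ξ : Measure Lam) [IsProbabilityMeasure ξ]
      (δ : ℝ) (hδ : 0 < δ) (f : ℝ × State n → Lam → State n)
      (hf : ∀ z ∈ cyl T X, AEMeasurable (f z) ξ)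
      (hX : ∀ z ∈ cyl T X, ∀ᵐ l ∂ξ, f z l ∈ X)
      (hcont : ∀ v : TestFun n, Continuous v →
        ContinuousOn (discreteGenerator ξ δ f v) (cyl T X)) :
      IsGenerator T X (contTest n) (discreteGenerator ξ δ f)
  | markov (P : MarkovProcess n) (C : Submodule ℝ (TestFun n)) (L : TestFun n → TestFun n)
      (h_one : (fun _ => 1 : TestFun n) ∈ C) (h_time : (fun z => z.1 : TestFun n) ∈ C)
      (hcont : ∀ v ∈ C, ContinuousOn v (cyl T X) ∧ ContinuousOn (L v) (cyl T X))
      (hint : ∀ v ∈ C, ∀ z ∈ cyl T X, ∀ᶠ h : ℝ≥0 in 𝓝[>] 0,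
        Integrable (fun y => v (z.1 + h, y)) (P.kernel z.1 h z.2))
      (hlim : ∀ v ∈ C, ∀ z ∈ cyl T X, Tendsto
        (fun h : ℝ≥0 => ((∫ y, v (z.1 + h, y) ∂(P.kernel z.1 h z.2)) - v z) / (h : ℝ))
        (𝓝[>] 0) (𝓝 (L v z))) :
      IsGenerator T X C L

/-! ### The measure program -/

section Programs

variable {n : ℕ} (T : ℝ) (X : Set (State n)) (C : Submodule ℝ (TestFun n))
  (L : TestFun n → TestFun n) (p : State n → ℝ) (μ₀ : Measure (State n)) (r : ℝ)

/-- `⟨p, μ⟩`. -/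
def mean (μ : Measure (ℝ × State n)) : ℝ := ∫ z, p z.2 ∂μ

/-- `⟨p², μ⟩`. -/
def secondMoment (μ : Measure (ℝ × State n)) : ℝ := ∫ z, p z.2 ^ 2 ∂μ

/-- The martingale (Liouville) relation `μτ = δ₀ ⊗ μ₀ + L† μ`. -/
def Liouville (μτ μ : Measure (ℝ × State n)) : Prop :=
  ∀ v ∈ C, ∫ z, v z ∂μτ = (∫ x, v (0, x) ∂μ₀) + ∫ z, L v z ∂μ

/-- The optimal value of the measure SOCP in the variables `(μτ, μ, c)`. -/
def primalValue : EReal :=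
  sSup {J : EReal | ∃ (μτ μ : Measure (ℝ × State n)) (c : ℝ),
    IsMeasureOn (cyl T X) μτ ∧ IsMeasureOn (cyl T X) μ ∧ Liouville C L μ₀ μτ μ ∧
    ((!₂[1 - secondMoment p μτ, 2 * c, 2 * mean p μτ], 1 + secondMoment p μτ) :
      EuclideanSpace ℝ (Fin 3) × ℝ) ∈ secondOrderCone 3 ∧
    J = ((r * c + mean p μτ : ℝ) : EReal)}

/-- The optimal value of the measure SOCP with an explicit conic variable
`z = ([z₁, z₂, z₃], z₄)`, here `z = (z.1, z.2)` with `z.1 0, z.1 1, z.1 2` and `z.2`. -/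
def primalConicValue : EReal :=
  sSup {J : EReal | ∃ (μτ μ : Measure (ℝ × State n)) (z : EuclideanSpace ℝ (Fin 3) × ℝ),
    IsMeasureOn (cyl T X) μτ ∧ IsMeasureOn (cyl T X) μ ∧ z ∈ secondOrderCone 3 ∧
    z.1 0 + secondMoment p μτ = 1 ∧ z.1 2 - 2 * mean p μτ = 0 ∧ z.1 0 + z.2 = 2 ∧
    Liouville C L μ₀ μτ μ ∧
    J = ((r / 2 * z.1 1 + mean p μτ : ℝ) : EReal)}

/-! ### The dual program -/

/-- The Lagrangian of the conic measure program: `u` is the multiplier of the three scalar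
equations, `v` the multiplier of the Liouville equation. -/
def lagrangian (μτ μ : Measure (ℝ × State n)) (z : EuclideanSpace ℝ (Fin 3) × ℝ)
    (v : TestFun n) (u : Fin 3 → ℝ) : ℝ :=
  r / 2 * z.1 1 + mean p μτ
    + u 0 * (1 - (z.1 0 + secondMoment p μτ))
    + u 1 * (0 - (z.1 2 - 2 * mean p μτ))
    + u 2 * (2 - (z.1 0 + z.2))
    + ((∫ x, v (0, x) ∂μ₀) + (∫ y, L v y ∂μ) - ∫ y, v y ∂μτ)

/-- The Lagrangian dual function: the supremum of the Lagrangian over the primal cones. -/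
def dualFunction (v : TestFun n) (u : Fin 3 → ℝ) : EReal :=
  sSup {J : EReal | ∃ (μτ μ : Measure (ℝ × State n)) (z : EuclideanSpace ℝ (Fin 3) × ℝ),
    IsMeasureOn (cyl T X) μτ ∧ IsMeasureOn (cyl T X) μ ∧ z ∈ secondOrderCone 3 ∧
    J = (lagrangian L p μ₀ r μτ μ z v u : EReal)}

/-- The value of the Lagrangian dual problem. -/
def lagrangianDualValue : EReal :=
  sInf {J : EReal | ∃ (v : TestFun n) (u : Fin 3 → ℝ),
    v ∈ C ∧ J = dualFunction T X L p μ₀ r v u}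

/-- The constraints of the dual program, where `(u₁, u₂, u₃) = (u 0, u 1, u 2)`. -/
structure DualFeasible (v : TestFun n) (u : Fin 3 → ℝ) : Prop where
  mem_dom : v ∈ C
  generator_nonpos : ∀ t ∈ Icc 0 T, ∀ x ∈ X, L v (t, x) ≤ 0
  terminal : ∀ t ∈ Icc 0 T, ∀ x ∈ X, p x ≤ v (t, x) + u 0 * p x ^ 2 - 2 * u 1 * p x
  soc : ((!₂[u 0 + u 2, -(r / 2), u 1], u 2) : EuclideanSpace ℝ (Fin 3) × ℝ) ∈ secondOrderCone 3

/-- The cost of the dual program. -/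
def dualCost (v : TestFun n) (u : Fin 3 → ℝ) : ℝ := u 0 + 2 * u 2 + ∫ x, v (0, x) ∂μ₀

/-- The optimal value of the dual program. -/
def dualValue : EReal :=
  sInf {J : EReal | ∃ (v : TestFun n) (u : Fin 3 → ℝ),
    DualFeasible T X C L p r v u ∧ J = (dualCost μ₀ v u : EReal)}

end Programs

end ChancePeak

end

/-! Grouping the Lagrangian by primal variable turns it into the dual cost plus one pairing for each
of `z`, `μτ` and `μ`. Each pairing is nonpositive on its cone exactly when the matching dual
constraint holds. Otherwise a ray along a Dirac mass, or along a vector of the second-order cone,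
sends the Lagrangian to infinity. This gives the dual function, and weak duality follows by
evaluating at feasible primal points.

Strong duality is proved from the dual side. The dual is a conic program over `C(K) × C(K) × (ℝ³ ×
ℝ)`, `K = [0, T] × X` compact, whose constraint map is linear because `L` is linear on the domain
when evaluated on `K`. The functions `1` and `t`, with `L 1 = 0` and `L t = 1`, make both function
inequalities slack, so a Slater condition holds (`exists_dualMap_add_mem`). For every real `d` below
the dual value, the Riesz extension theorem then gives a positive functional `g`
(`exists_conic_multiplier`). By Riesz–Markov–Kakutani on compact `K` and self-duality of the
second-order cone, `g` consists of two measures and a vector `z`. That `g` composed with the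
constraint map is the dual cost says that these are primal feasible, and `g b ≥ d` bounds their
objective from below. -/

noncomputable section

namespace ChancePeak

/-! ### Conic duality from the Riesz extension theorem -/

section ConicDuality

variable {V E : Type*} [AddCommGroup V] [Module ℝ V] [AddCommGroup E] [Module ℝ E]

/-- A functional which is nonnegative on the preimage of a cone under `Φ` factors through `Φ`, via a
functional which is nonnegative on the cone. -/
theorem exists_nonneg_comp_eq (s : PointedCone ℝ E) (Φ : V →ₗ[ℝ] E) (f : V →ₗ[ℝ] ℝ)
    (hf : ∀ w, Φ w ∈ s → 0 ≤ f w) (hs : ∀ y, ∃ w, Φ w + y ∈ s) :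
    ∃ g : E →ₗ[ℝ] ℝ, (∀ w, g (Φ w) = f w) ∧ ∀ x ∈ s, 0 ≤ g x := by
  -- The extension is made on `V × E`, from the subspace `V × 0`, with the cone `{(w, y) | Φ w + y ∈
  -- s}`. This avoids showing beforehand that `f` vanishes on the kernel of `Φ`.
  let Ψ : V × E →ₗ[ℝ] E := Φ.coprod LinearMap.id
  let F : V × E →ₗ.[ℝ] ℝ :=
    ⟨LinearMap.range (LinearMap.inl ℝ V E), (f ∘ₗ LinearMap.fst ℝ V E).domRestrict _⟩
  have hΨ : ∀ x : V × E, x ∈ PointedCone.comap Ψ s ↔ Φ x.1 + x.2 ∈ s := fun x => by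
    simp [Ψ, PointedCone.mem_comap]
  obtain ⟨g, hg, hg0⟩ := riesz_extension (PointedCone.comap Ψ s) F
    (by
      rintro ⟨-, w, rfl⟩ hw
      rw [hΨ] at hw
      exact hf w (by simpa using hw))
    (by
      rintro ⟨w, y⟩
      obtain ⟨w', hw'⟩ := hs y
      refine ⟨⟨LinearMap.inl ℝ V E (w' - w), LinearMap.mem_range_self _ _⟩, ?_⟩
      rw [hΨ]
      simpa using hw')
  refine ⟨g ∘ₗ LinearMap.inr ℝ V E, fun w => ?_, fun x hx => hg0 _ ((hΨ _).2 (by simpa using hx))⟩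
  have h1 : g (w, 0) = f w := hg ⟨LinearMap.inl ℝ V E w, LinearMap.mem_range_self _ _⟩
  -- Both `(-w, Φ w)` and its opposite are sent to `0 ∈ s`, so `g` vanishes there; this is the
  -- factorization.
  have h2 : 0 ≤ g (-w, Φ w) := hg0 _ ((hΨ _).2 (by simp))
  have h3 : 0 ≤ g (w, -Φ w) := hg0 _ ((hΨ _).2 (by simp))
  have e2 : g (-w, Φ w) = g (0, Φ w) - g (w, 0) := by rw [← map_sub]; simp
  have e3 : g (w, -Φ w) = g (w, 0) - g (0, Φ w) := by rw [← map_sub]; simp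
  simp only [LinearMap.comp_apply, LinearMap.inr_apply]
  linarith

/-- Strong duality for the conic program `inf {f w | Φ w - b ∈ s}` under a Slater condition. -/
theorem exists_conic_multiplier (s : PointedCone ℝ E) (Φ : V →ₗ[ℝ] E) (f : V →ₗ[ℝ] ℝ) (b : E)
    (d : ℝ) (hd : ∀ w, Φ w - b ∈ s → d ≤ f w) (hs : ∀ y, ∃ w, Φ w + y ∈ s) :
    ∃ g : E →ₗ[ℝ] ℝ, (∀ w, g (Φ w) = f w) ∧ (∀ x ∈ s, 0 ≤ g x) ∧ d ≤ g b := by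
  -- Homogenization: a scalar `t ≥ 0` multiplies `b` and `d`, which reduces the affine program to
  -- the preceding theorem.
  let s' : PointedCone ℝ (E × ℝ) := Submodule.prod s (PointedCone.positive ℝ ℝ)
  have hs' : ∀ x : E × ℝ, x ∈ s' ↔ x.1 ∈ s ∧ 0 ≤ x.2 := fun x => by
    simp [s', Submodule.mem_prod]
  let Φ' : V × ℝ →ₗ[ℝ] E × ℝ :=
    (Φ ∘ₗ LinearMap.fst ℝ V ℝ - (LinearMap.snd ℝ V ℝ).smulRight b).prod (LinearMap.snd ℝ V ℝ)
  have hΦ' : ∀ w t, Φ' (w, t) = (Φ w - t • b, t) := fun w t => rfl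
  let f' : V × ℝ →ₗ[ℝ] ℝ := f ∘ₗ LinearMap.fst ℝ V ℝ - d • LinearMap.snd ℝ V ℝ
  have hf' : ∀ w t, f' (w, t) = f w - d * t := fun w t => rfl
  obtain ⟨w₀, hw₀⟩ := hs (-b)
  -- The case `t = 0`: adding multiples of a recession direction of negative cost to the feasible
  -- point `w₀` would bring the cost below `d`.
  have hrec : ∀ w, Φ w ∈ s → 0 ≤ f w := by
    intro w hw
    by_contra! hneg
    obtain ⟨m, hm⟩ := exists_nat_gt ((f w₀ - d) / (-f w))
    rw [div_lt_iff₀ (by linarith)] at hm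
    have := hd (w₀ + m • w) (by
      rw [map_add, map_nsmul, add_sub_right_comm, sub_eq_add_neg]
      exact s.add_mem hw₀ (s.nsmul_mem hw m))
    rw [map_add, map_nsmul, nsmul_eq_mul] at this
    linarith
  obtain ⟨g, hg, hg0⟩ := exists_nonneg_comp_eq s' Φ' f'
    (by
      rintro ⟨w, t⟩ hw
      rw [hs', hΦ'] at hw
      obtain ⟨hw, ht⟩ := hw
      simp only at hw ht
      rw [hf']
      rcases ht.eq_or_lt with rfl | ht
      · simpa using hrec w (by simpa using hw)
      · have h1 := PointedCone.smul_mem s (inv_nonneg.2 ht.le) hw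
        have h2 := hd (t⁻¹ • w) (by
          have e : Φ (t⁻¹ • w) - b = t⁻¹ • (Φ w - t • b) := by
            rw [smul_sub, smul_smul, inv_mul_cancel₀ ht.ne', one_smul, map_smul]
          rw [e]
          exact h1)
        rw [map_smul, smul_eq_mul, ← div_eq_inv_mul, le_div_iff₀ ht] at h2
        linarith)
    (by
      rintro ⟨y, t⟩
      -- With scalar `|t|`, the last coordinate `|t| + t` is nonnegative whatever the sign of `t`.
      obtain ⟨w, hw⟩ := hs (y - |t| • b)
      refine ⟨(w, |t|), ?_⟩
      rw [hs', hΦ']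
      refine ⟨?_, ?_⟩
      · convert hw using 1
        simp only [Prod.fst_add]
        abel
      · simpa using by linarith [neg_abs_le t])
  refine ⟨g ∘ₗ LinearMap.inl ℝ E ℝ, fun w => ?_, fun x hx => hg0 _ ((hs' _).2 ⟨hx, le_rfl⟩), ?_⟩
  · have := hg (w, 0)
    rw [hΦ', hf'] at this
    simpa using this
  -- At `(0, 1)` the factorization reads `g (0, 1) - g (b, 0) = -d`, and `g (0, 1) ≥ 0`.
  · have h1 := hg (0, 1)
    rw [hΦ', hf'] at h1
    have h2 : 0 ≤ g (0, 1) := hg0 _ ((hs' _).2 ⟨s.zero_mem, zero_le_one⟩)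
    have e : g (Φ 0 - (1 : ℝ) • b, 1) = g (0, 1) - g (b, 0) := by rw [← map_sub]; simp
    rw [e, map_zero] at h1
    simp only [LinearMap.comp_apply, LinearMap.inl_apply]
    linarith

end ConicDuality

/-! ### The second-order cone -/

/-- The second-order cone in `ℝᵏ × ℝ` as a pointed cone. -/
def socCone (k : ℕ) : PointedCone ℝ (EuclideanSpace ℝ (Fin k) × ℝ) where
  carrier := secondOrderCone k
  add_mem' := fun {a b} ha hb => (norm_add_le a.1 b.1).trans (add_le_add ha hb)
  zero_mem' := by simp [secondOrderCone]
  smul_mem' := fun c x hx => by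
    change ‖(c : ℝ) • x.1‖ ≤ (c : ℝ) * x.2
    rw [norm_smul, Real.norm_of_nonneg c.2]
    exact mul_le_mul_of_nonneg_left hx c.2

lemma mem_socCone {k : ℕ} {x : EuclideanSpace ℝ (Fin k) × ℝ} :
    x ∈ socCone k ↔ x ∈ secondOrderCone k := Iff.rfl

/-- The pairing of `ℝᵏ × ℝ` with itself for which the second-order cone is self-dual. -/
def socPairing {k : ℕ} (x z : EuclideanSpace ℝ (Fin k) × ℝ) : ℝ := inner ℝ x.1 z.1 + x.2 * z.2

lemma socPairing_smul_right {k : ℕ} (x z : EuclideanSpace ℝ (Fin k) × ℝ) (a : ℝ) :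
    socPairing x (a • z) = a * socPairing x z := by
  simp only [socPairing, Prod.smul_fst, Prod.smul_snd, inner_smul_right, smul_eq_mul]
  ring

lemma socPairing_nonneg {k : ℕ} {x z : EuclideanSpace ℝ (Fin k) × ℝ}
    (hx : x ∈ secondOrderCone k) (hz : z ∈ secondOrderCone k) : 0 ≤ socPairing x z := by
  have h1 := (abs_le.1 (abs_real_inner_le_norm x.1 z.1)).1
  have h2 : ‖x.1‖ * ‖z.1‖ ≤ x.2 * z.2 :=
    mul_le_mul hx hz (norm_nonneg _) ((norm_nonneg _).trans hx)
  unfold socPairing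
  linarith

/-- The hard half of self-duality: testing against `(-x.1, ‖x.1‖)` on the boundary of the cone
suffices, after division by `‖x.1‖`. If `x.1 = 0`, the axis vector `(0, 1)` is used instead. -/
lemma mem_secondOrderCone_of_socPairing_nonneg {k : ℕ} {x : EuclideanSpace ℝ (Fin k) × ℝ}
    (h : ∀ z ∈ secondOrderCone k, 0 ≤ socPairing x z) : x ∈ secondOrderCone k := by
  change ‖x.1‖ ≤ x.2
  rcases (norm_nonneg x.1).eq_or_lt with h0 | h0
  · have := h (0, 1) (by simp [secondOrderCone])
    rw [← h0]
    simpa [socPairing] using this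
  · have h1 := h (-x.1, ‖x.1‖) (by simp [secondOrderCone])
    simp only [socPairing, inner_neg_right, real_inner_self_eq_norm_sq] at h1
    nlinarith

/-- A functional on `ℝᵏ × ℝ` which is nonnegative on the second-order cone is the pairing with an
element of the cone. -/
lemma exists_socPairing_eq {k : ℕ} (g : EuclideanSpace ℝ (Fin k) × ℝ →ₗ[ℝ] ℝ)
    (hg : ∀ x ∈ secondOrderCone k, 0 ≤ g x) :
    ∃ z ∈ secondOrderCone k, ∀ x, g x = socPairing z x := by
  let g₁ := LinearMap.toContinuousLinearMap (g ∘ₗ LinearMap.inl ℝ (EuclideanSpace ℝ (Fin k)) ℝ)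
  have key : ∀ x, g x = socPairing ((InnerProductSpace.toDual ℝ _).symm g₁, g (0, 1)) x := by
    rintro ⟨y, t⟩
    have e : ((y, t) : EuclideanSpace ℝ (Fin k) × ℝ) = (y, 0) + t • (0, 1) := by simp
    simp only [socPairing, InnerProductSpace.toDual_symm_apply]
    rw [e, map_add, map_smul, smul_eq_mul, mul_comm]
    simp [g₁]
  refine ⟨_, mem_secondOrderCone_of_socPairing_nonneg fun z hz => ?_, key⟩
  rw [← key]
  exact hg z hz

/-! ### Positive functionals on continuous functions -/

/-- The restriction to `K` of a function which is continuous on `K`. -/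
def restrictCont {α : Type*} [TopologicalSpace α] {K : Set α} (h : α → ℝ) (hh : ContinuousOn h K) :
    C(K, ℝ) := ⟨K.domRestrict h, hh.domRestrict⟩

@[simp] lemma restrictCont_apply {α : Type*} [TopologicalSpace α] {K : Set α} (h : α → ℝ)
    (hh : ContinuousOn h K) (x : K) : restrictCont h hh x = h x := rfl

open scoped CompactlySupported in
/-- A positive functional on the continuous functions on a compact subset of a metric space is
integration against a finite measure supported in that set. -/
lemma exists_measure_of_nonneg {α : Type*} [MetricSpace α] [MeasurableSpace α] [BorelSpace α]
    {K : Set α} (hK : IsCompact K) (g : C(K, ℝ) →ₗ[ℝ] ℝ) (hg : ∀ φ, 0 ≤ φ → 0 ≤ g φ) :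
    ∃ μ : Measure α, IsMeasureOn K μ ∧ ∀ (h : α → ℝ) (hh : ContinuousOn h K),
      g (restrictCont h hh) = ∫ x, h x ∂μ := by
  have : CompactSpace K := isCompact_iff_compactSpace.1 hK
  let Λ₀ : C_c(K, ℝ) →ₗ[ℝ] ℝ :=
    { toFun := fun φ => g φ.toContinuousMap
      map_add' := fun φ ψ => g.map_add φ.toContinuousMap ψ.toContinuousMap
      map_smul' := fun c φ => g.map_smul c φ.toContinuousMap }
  let Λ : C_c(K, ℝ) →ₚ[ℝ] ℝ := PositiveLinearMap.mk₀ Λ₀ fun φ hφ => hg _ fun x => hφ x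
  have hm : MeasurableSet K := hK.measurableSet
  have : IsFiniteMeasure (RealRMK.rieszMeasure Λ) :=
    ⟨isCompact_univ.measure_lt_top⟩
  -- The representing measure lives on the subtype `K`; pushing it forward along the inclusion gives
  -- a measure on `α` that does not charge the complement of `K`.
  refine ⟨(RealRMK.rieszMeasure Λ).map Subtype.val, ⟨inferInstance, ?_⟩, fun h hh => ?_⟩
  · rw [Measure.map_apply measurable_subtype_coe hm.compl]
    simp
  · rw [(MeasurableEmbedding.subtype_coe hm).integral_map]
    exact (RealRMK.integral_rieszMeasure Λ
      (CompactlySupportedContinuousMap.continuousMapEquiv (restrictCont h hh))).symm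

lemma integrable_of_continuousOn {α : Type*} [MetricSpace α] [MeasurableSpace α] [BorelSpace α]
    {K : Set α} (hK : IsCompact K) {μ : Measure α} (hμ : IsMeasureOn K μ) {h : α → ℝ}
    (hh : ContinuousOn h K) : Integrable h μ := by
  have := hμ.1
  have : μ.restrict K = μ := Measure.restrict_eq_self_of_ae_mem (by
    rw [ae_iff]; exact hμ.2)
  rw [← this]
  exact hh.integrableOn_compact' hK hK.measurableSet

lemma integral_nonneg_of_isMeasureOn {α : Type*} [MeasurableSpace α] {K : Set α} {μ : Measure α}
    (hμ : IsMeasureOn K μ) {h : α → ℝ} (hh : ∀ x ∈ K, 0 ≤ h x) : 0 ≤ ∫ x, h x ∂μ := by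
  have hae : ∀ᵐ x ∂μ, x ∈ K := by
    rw [ae_iff]
    exact hμ.2
  exact integral_nonneg_of_ae (hae.mono fun x hx => hh x hx)

/-! ### Common properties of the generators -/

/-- The properties of a generator used by the duality theory. -/
structure GeneratorLaws {n : ℕ} (K : Set (ℝ × State n)) (C : Submodule ℝ (TestFun n))
    (L : TestFun n → TestFun n) : Prop where
  cont : ∀ v ∈ C, ContinuousOn v K
  cont_gen : ∀ v ∈ C, ContinuousOn (L v) K
  add : ∀ v ∈ C, ∀ w ∈ C, ∀ z ∈ K, L (v + w) z = L v z + L w z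
  smul : ∀ (c : ℝ), ∀ v ∈ C, ∀ z ∈ K, L (c • v) z = c * L v z
  one_mem : (fun _ => 1 : TestFun n) ∈ C
  time_mem : (fun z => z.1 : TestFun n) ∈ C
  gen_one : ∀ z ∈ K, L (fun _ => 1) z = 0
  gen_time : ∀ z ∈ K, L (fun z => z.1) z = 1

/-- Serves to place `1` and `t` in the domain of the Itô generator. -/
lemma isC12_time {n : ℕ} (φ : ℝ → ℝ) (hφ : ContDiff ℝ 1 φ) :
    IsC12 (fun z : ℝ × State n => φ z.1) := by
  refine ⟨hφ.continuous.comp continuous_fst, fun t x => hφ.differentiable (by norm_num) t,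
    fun t => contDiff_const (c := φ t), ?_, ?_, ?_⟩
  · exact (hφ.continuous_deriv (by norm_num)).comp continuous_fst
  · simp [continuous_const]
  · simp [continuous_const]

lemma generatorLaws_ito {n m : ℕ} {K : Set (ℝ × State n)} {f : ℝ × State n → State n}
    {g : ℝ × State n → Fin m → State n} (hf : ContinuousOn f K) (hg : ContinuousOn g K) :
    GeneratorLaws K (c12 n) (itoGenerator f g) where
  cont v hv := (IsC12.continuous hv).continuousOn
  cont_gen v hv := by
    have hv : IsC12 v := hv
    refine (hv.cont_time.continuousOn.add (hv.cont_space.continuousOn.clm_apply hf)).add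
      (continuousOn_const.mul (continuousOn_finsetSum _ fun j _ => ?_))
    have hj : ContinuousOn (fun z => g z j) K := (continuous_apply j).comp_continuousOn hg
    exact (hv.cont_space_two.continuousOn.clm_apply hj).clm_apply hj
  add v hv w hw z _ := by
    have hv : IsC12 v := hv
    have hw : IsC12 w := hw
    have e1 : fderiv ℝ (fun y => (v + w) (z.1, y)) =
        fun x => fderiv ℝ (fun y => v (z.1, y)) x + fderiv ℝ (fun y => w (z.1, y)) x := by
      funext x
      exact fderiv_fun_add ((hv.diff_space z.1).differentiable (by norm_num) x)
        ((hw.diff_space z.1).differentiable (by norm_num) x)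
    have e0 : deriv (fun s => (v + w) (s, z.2)) z.1 =
        deriv (fun s => v (s, z.2)) z.1 + deriv (fun s => w (s, z.2)) z.1 :=
      deriv_fun_add (hv.diff_time z.1 z.2) (hw.diff_time z.1 z.2)
    have e2 : fderiv ℝ (fderiv ℝ (fun y => (v + w) (z.1, y))) z.2 =
        fderiv ℝ (fderiv ℝ (fun y => v (z.1, y))) z.2 +
          fderiv ℝ (fderiv ℝ (fun y => w (z.1, y))) z.2 := by
      rw [e1]
      exact fderiv_fun_add (hv.fderiv_diff z.1 z.2) (hw.fderiv_diff z.1 z.2)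
    simp only [itoGenerator]
    rw [e2, e1, e0]
    simp only [add_apply, Finset.sum_add_distrib]
    ring
  smul c v hv z _ := by
    have hv : IsC12 v := hv
    have e1 : fderiv ℝ (fun y => (c • v) (z.1, y)) =
        fun x => c • fderiv ℝ (fun y => v (z.1, y)) x := by
      funext x
      exact fderiv_fun_const_smul ((hv.diff_space z.1).differentiable (by norm_num) x) c
    have e0 : deriv (fun s => (c • v) (s, z.2)) z.1 = c • deriv (fun s => v (s, z.2)) z.1 :=
      deriv_fun_const_smul c (hv.diff_time z.1 z.2)
    have e2 : fderiv ℝ (fderiv ℝ (fun y => (c • v) (z.1, y))) z.2 =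
        c • fderiv ℝ (fderiv ℝ (fun y => v (z.1, y))) z.2 := by
      rw [e1]
      exact fderiv_fun_const_smul (hv.fderiv_diff z.1 z.2) c
    simp only [itoGenerator]
    rw [e2, e1, e0]
    simp only [smul_apply, smul_eq_mul, ← Finset.mul_sum]
    ring
  one_mem := isC12_time (fun _ => 1) contDiff_const
  time_mem := isC12_time (fun t => t) contDiff_id
  gen_one z _ := by simp [itoGenerator]
  gen_time z _ := by simp [itoGenerator]

lemma generatorLaws_discrete {n : ℕ} {T : ℝ} {X : Set (State n)} (hXc : IsCompact X)
    {Lam : Type u} [MeasurableSpace Lam] (ξ : Measure Lam) [IsProbabilityMeasure ξ]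
    {δ : ℝ} (hδ : 0 < δ) {f : ℝ × State n → Lam → State n}
    (hf : ∀ z ∈ cyl T X, AEMeasurable (f z) ξ) (hX : ∀ z ∈ cyl T X, ∀ᵐ l ∂ξ, f z l ∈ X)
    (hcont : ∀ v : TestFun n, Continuous v →
      ContinuousOn (discreteGenerator ξ δ f v) (cyl T X)) :
    GeneratorLaws (cyl T X) (contTest n) (discreteGenerator ξ δ f) := by
  have hint : ∀ v : TestFun n, Continuous v → ∀ z ∈ cyl T X,
      Integrable (fun l => v (z.1 + δ, f z l)) ξ := by
    intro v hv z hz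
    have hv' : Continuous fun y => v (z.1 + δ, y) := hv.comp (by fun_prop)
    -- The next state lies almost surely in the compact set `X`, so the integrand is essentially
    -- bounded even if `v` is unbounded on `ℝⁿ`.
    obtain ⟨B, hB⟩ := hXc.exists_bound_of_continuousOn hv'.continuousOn
    exact Integrable.of_bound (hv'.measurable.comp_aemeasurable (hf z hz)).aestronglyMeasurable B
      ((hX z hz).mono fun l hl => hB _ hl)
  refine ⟨fun v hv => Continuous.continuousOn hv, fun v hv => hcont v hv, ?_, ?_,
    continuous_const, continuous_fst, ?_, ?_⟩
  · intro v hv w hw z hz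
    simp only [discreteGenerator, Pi.add_apply]
    rw [integral_add (hint v hv z hz) (hint w hw z hz)]
    ring
  · intro c v hv z hz
    simp only [discreteGenerator, Pi.smul_apply, smul_eq_mul]
    rw [integral_const_mul]
    ring
  · intro z _
    simp [discreteGenerator]
  · intro z _
    simp [discreteGenerator, hδ.ne']

lemma generatorLaws_markov {n : ℕ} {K : Set (ℝ × State n)}
    (P : MarkovProcess n) (C : Submodule ℝ (TestFun n)) (L : TestFun n → TestFun n)
    (h_one : (fun _ => 1 : TestFun n) ∈ C) (h_time : (fun z => z.1 : TestFun n) ∈ C)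
    (hcont : ∀ v ∈ C, ContinuousOn v K ∧ ContinuousOn (L v) K)
    (hint : ∀ v ∈ C, ∀ z ∈ K, ∀ᶠ h : ℝ≥0 in 𝓝[>] 0,
      Integrable (fun y => v (z.1 + h, y)) (P.kernel z.1 h z.2))
    (hlim : ∀ v ∈ C, ∀ z ∈ K, Tendsto
      (fun h : ℝ≥0 => ((∫ y, v (z.1 + h, y) ∂(P.kernel z.1 h z.2)) - v z) / (h : ℝ))
      (𝓝[>] 0) (𝓝 (L v z))) :
    GeneratorLaws K C L := by
  have := P.markov
  refine ⟨fun v hv => (hcont v hv).1, fun v hv => (hcont v hv).2, ?_, ?_, h_one, h_time, ?_, ?_⟩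
  · intro v hv w hw z hz
    -- Each algebraic law holds for the difference quotients at small `h > 0` and passes to the
    -- limit by uniqueness.
    refine tendsto_nhds_unique (hlim _ (C.add_mem hv hw) z hz)
      (((hlim v hv z hz).add (hlim w hw z hz)).congr' ?_)
    filter_upwards [hint v hv z hz, hint w hw z hz] with h h1 h2
    simp only [Pi.add_apply]
    rw [integral_add h1 h2]
    ring
  · intro c v hv z hz
    refine tendsto_nhds_unique (hlim _ (C.smul_mem c hv) z hz)
      (((hlim v hv z hz).const_mul c).congr fun h => ?_)
    simp only [Pi.smul_apply, smul_eq_mul]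
    rw [integral_const_mul]
    ring
  · intro z hz
    refine tendsto_nhds_unique (hlim _ h_one z hz) (tendsto_const_nhds.congr fun h => ?_)
    simp
  · intro z hz
    refine tendsto_nhds_unique (hlim _ h_time z hz) (tendsto_const_nhds.congr' ?_)
    filter_upwards [self_mem_nhdsWithin] with h hh
    have : (h : ℝ) ≠ 0 := by exact_mod_cast (ne_of_gt hh)
    simp [this]

theorem IsGenerator.laws {n : ℕ} {T : ℝ} {X : Set (State n)} (hX : IsCompact X)
    {C : Submodule ℝ (TestFun n)} {L : TestFun n → TestFun n} (hL : IsGenerator.{u} T X C L) :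
    GeneratorLaws (cyl T X) C L := by
  cases hL with
  | ito f g hf hg => exact generatorLaws_ito hf hg
  | discrete ξ δ hδ f hf hfX hcont => exact generatorLaws_discrete hX ξ hδ hf hfX hcont
  | markov P _ _ h_one h_time hcont hint hlim =>
    exact generatorLaws_markov P C L h_one h_time hcont hint hlim

/-! ### The Lagrangian dual -/

lemma isMeasureOn_zero {α : Type*} [MeasurableSpace α] (S : Set α) :
    IsMeasureOn S (0 : Measure α) := ⟨inferInstance, rfl⟩

lemma isMeasureOn_smul_dirac {α : Type*} [MeasurableSpace α] [MeasurableSingletonClass α]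
    {S : Set α} {x : α} (hx : x ∈ S) (a : ℝ≥0) : IsMeasureOn S (a • Measure.dirac x) :=
  ⟨inferInstance, by simp [hx]⟩

lemma integral_smul_dirac {α : Type*} [MeasurableSpace α] [MeasurableSingletonClass α]
    (x : α) (a : ℝ≥0) (h : α → ℝ) : ∫ y, h y ∂(a • Measure.dirac x) = a * h x := by
  rw [integral_smul_nnreal_measure, integral_dirac]
  rfl

lemma isCompact_cyl {n : ℕ} (T : ℝ) {X : Set (State n)} (hX : IsCompact X) :
    IsCompact (cyl T X) := isCompact_Icc.prod hX

lemma continuousOn_cyl_snd {n : ℕ} (T : ℝ) {X : Set (State n)} {p : State n → ℝ}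
    (hp : ContinuousOn p X) : ContinuousOn (fun z : ℝ × State n => p z.2) (cyl T X) :=
  hp.comp continuous_snd.continuousOn fun _ hz => hz.2

/-- Used with the values of the Lagrangian along a ray of the primal cones on which it increases. -/
lemma sSup_eq_top_of_affine_mem {S : Set EReal} (a κ : ℝ) (hκ : 0 < κ)
    (h : ∀ t : ℝ≥0, ((a + t * κ : ℝ) : EReal) ∈ S) : sSup S = ⊤ := by
  rw [EReal.eq_top_iff_forall_lt]
  intro M
  obtain ⟨m, hm⟩ := exists_nat_gt ((M - a) / κ)
  rw [div_lt_iff₀ hκ] at hm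
  refine lt_of_lt_of_le ?_ (le_sSup (h m))
  rw [EReal.coe_lt_coe_iff]
  simp only [NNReal.coe_natCast]
  linarith

section Programs

variable {n : ℕ} {T : ℝ} {X : Set (State n)} {C : Submodule ℝ (TestFun n)}
  {L : TestFun n → TestFun n} {p : State n → ℝ} {μ₀ : Measure (State n)} {r : ℝ}

/-- The conic part of the dual constraints. -/
def dualConic (r : ℝ) (w : Fin 3 → ℝ) : EuclideanSpace ℝ (Fin 3) × ℝ :=
  (!₂[w 0 + w 2, -(r / 2), w 1], w 2)

/-- The regrouping by primal variable. Splitting the `μτ` integral needs integrability, which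
continuity on a compact set provides. -/
lemma lagrangian_eq (hX : IsCompact X) (hG : GeneratorLaws (cyl T X) C L) (hp : ContinuousOn p X)
    {v : TestFun n} (hv : v ∈ C) (w : Fin 3 → ℝ) {μτ : Measure (ℝ × State n)}
    (hτ : IsMeasureOn (cyl T X) μτ) (μ : Measure (ℝ × State n))
    (z : EuclideanSpace ℝ (Fin 3) × ℝ) :
    lagrangian L p μ₀ r μτ μ z v w = dualCost μ₀ v w - socPairing (dualConic r w) z
      - (∫ y, (v y + w 0 * p y.2 ^ 2 - 2 * w 1 * p y.2 - p y.2) ∂μτ) + ∫ y, L v y ∂μ := by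
  have hK := isCompact_cyl T hX
  have hpK := continuousOn_cyl_snd T hp
  have i1 : Integrable (fun y => p y.2) μτ := integrable_of_continuousOn hK hτ hpK
  have i2 : Integrable (fun y => p y.2 ^ 2) μτ := integrable_of_continuousOn hK hτ (hpK.pow 2)
  have i3 : Integrable v μτ := integrable_of_continuousOn hK hτ (hG.cont v hv)
  have j2 : Integrable (fun y => w 0 * p y.2 ^ 2) μτ := i2.const_mul _
  have j1 : Integrable (fun y => 2 * w 1 * p y.2) μτ := i1.const_mul _
  have j3 : Integrable (fun y => v y + w 0 * p y.2 ^ 2) μτ := i3.add j2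
  have j4 : Integrable (fun y => v y + w 0 * p y.2 ^ 2 - 2 * w 1 * p y.2) μτ := j3.sub j1
  rw [integral_sub j4 i1, integral_sub j3 j1, integral_add i3 j2, integral_const_mul,
    integral_const_mul]
  simp only [lagrangian, dualCost, socPairing, dualConic, mean, secondMoment,
    PiLp.inner_apply, Fin.sum_univ_three]
  simp
  ring

lemma dualFunction_of_feasible (hX : IsCompact X) (hG : GeneratorLaws (cyl T X) C L)
    (hp : ContinuousOn p X) {v : TestFun n} {w : Fin 3 → ℝ} (h : DualFeasible T X C L p r v w) :
    dualFunction T X L p μ₀ r v w = (dualCost μ₀ v w : EReal) := by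
  apply le_antisymm
  · refine sSup_le ?_
    rintro J ⟨μτ, μ, z, hτ, hμ, hz, rfl⟩
    rw [EReal.coe_le_coe_iff, lagrangian_eq hX hG hp h.mem_dom w hτ]
    have h1 : 0 ≤ socPairing (dualConic r w) z := socPairing_nonneg h.soc hz
    have h2 : 0 ≤ ∫ y, (v y + w 0 * p y.2 ^ 2 - 2 * w 1 * p y.2 - p y.2) ∂μτ :=
      integral_nonneg_of_isMeasureOn hτ fun y hy => sub_nonneg.2 (h.terminal y.1 hy.1 y.2 hy.2)
    have h3 : 0 ≤ ∫ y, -L v y ∂μ :=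
      integral_nonneg_of_isMeasureOn hμ fun y hy =>
        neg_nonneg.2 (h.generator_nonpos y.1 hy.1 y.2 hy.2)
    rw [integral_neg] at h3
    linarith
  -- The supremum is attained at the apex of the cones, where only the constant term is left.
  · refine le_sSup ⟨0, 0, 0, isMeasureOn_zero _, isMeasureOn_zero _, by simp [secondOrderCone], ?_⟩
    rw [lagrangian_eq hX hG hp h.mem_dom w (isMeasureOn_zero _)]
    simp [socPairing]

/-- Each violated constraint provides a ray: multiples of a Dirac mass at the offending point for
`μ` or `μτ`, or multiples of a `z` pairing negatively with `dualConic r w`. -/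
lemma dualFunction_of_not_feasible (hX : IsCompact X) (hG : GeneratorLaws (cyl T X) C L)
    (hp : ContinuousOn p X) {v : TestFun n} (hv : v ∈ C) {w : Fin 3 → ℝ}
    (h : ¬ DualFeasible T X C L p r v w) : dualFunction T X L p μ₀ r v w = ⊤ := by
  have h0 : (0 : EuclideanSpace ℝ (Fin 3) × ℝ) ∈ secondOrderCone 3 := by simp [secondOrderCone]
  by_cases h1 : ∀ t ∈ Icc 0 T, ∀ x ∈ X, L v (t, x) ≤ 0
  swap
  · push Not at h1
    obtain ⟨t, ht, x, hx, hpos⟩ := h1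
    have htx : (t, x) ∈ cyl T X := ⟨ht, hx⟩
    refine sSup_eq_top_of_affine_mem (dualCost μ₀ v w) _ hpos fun a =>
      ⟨0, a • Measure.dirac (t, x), 0, isMeasureOn_zero _, isMeasureOn_smul_dirac htx a,
        h0, ?_⟩
    rw [lagrangian_eq hX hG hp hv w (isMeasureOn_zero _), integral_smul_dirac]
    simp [socPairing]
  by_cases h2 : ∀ t ∈ Icc 0 T, ∀ x ∈ X, p x ≤ v (t, x) + w 0 * p x ^ 2 - 2 * w 1 * p x
  swap
  · push Not at h2
    obtain ⟨t, ht, x, hx, hpos⟩ := h2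
    have htx : (t, x) ∈ cyl T X := ⟨ht, hx⟩
    refine sSup_eq_top_of_affine_mem (dualCost μ₀ v w) _ (sub_pos.2 hpos) fun a =>
      ⟨a • Measure.dirac (t, x), 0, 0, isMeasureOn_smul_dirac htx a, isMeasureOn_zero _,
        h0, ?_⟩
    rw [lagrangian_eq hX hG hp hv w (isMeasureOn_smul_dirac htx a), integral_smul_dirac,
      EReal.coe_eq_coe_iff]
    simp [socPairing]
    ring
  · have h3 : dualConic r w ∉ secondOrderCone 3 := fun h3 => h ⟨hv, h1, h2, h3⟩
    have h4 : ∃ z ∈ secondOrderCone 3, socPairing (dualConic r w) z < 0 := by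
      by_contra! h4
      exact h3 (mem_secondOrderCone_of_socPairing_nonneg h4)
    obtain ⟨z, hz, hneg⟩ := h4
    refine sSup_eq_top_of_affine_mem (dualCost μ₀ v w) _ (neg_pos.2 hneg) fun a =>
      ⟨0, 0, (a : ℝ) • z, isMeasureOn_zero _, isMeasureOn_zero _,
        PointedCone.smul_mem (socCone 3) a.2 hz, ?_⟩
    rw [lagrangian_eq hX hG hp hv w (isMeasureOn_zero _), socPairing_smul_right,
      EReal.coe_eq_coe_iff]
    simp
    ring

lemma lagrangianDualValue_eq (hX : IsCompact X) (hG : GeneratorLaws (cyl T X) C L)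
    (hp : ContinuousOn p X) :
    lagrangianDualValue T X C L p μ₀ r = dualValue T X C L p μ₀ r := by
  apply le_antisymm
  · refine le_sInf ?_
    rintro J ⟨v, w, h, rfl⟩
    exact sInf_le ⟨v, w, h.mem_dom, (dualFunction_of_feasible hX hG hp h).symm⟩
  · refine le_sInf ?_
    rintro J ⟨v, w, hv, rfl⟩
    by_cases h : DualFeasible T X C L p r v w
    · rw [dualFunction_of_feasible hX hG hp h]
      exact sInf_le ⟨v, w, h, rfl⟩
    · rw [dualFunction_of_not_feasible hX hG hp hv h]
      exact le_top

lemma primalConicValue_eq :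
    primalConicValue T X C L p μ₀ r = primalValue T X C L p μ₀ r := by
  unfold primalConicValue primalValue
  congr 1
  ext J
  constructor
  · rintro ⟨μτ, μ, ⟨y, s⟩, hτ, hμ, hz, e1, e2, e3, hl, rfl⟩
    simp only at e1 e2 e3
    -- The scalar equations determine every coordinate of `z` except the second, which is `2c`.
    refine ⟨μτ, μ, y 1 / 2, hτ, hμ, hl, ?_, ?_⟩
    · convert hz using 2
      · ext i
        fin_cases i
        · simp; linarith
        · simp; ring
        · simp; linarith
      · linarith
    · rw [EReal.coe_eq_coe_iff]
      ring
  · rintro ⟨μτ, μ, c, hτ, hμ, hl, hz, rfl⟩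
    refine ⟨μτ, μ, _, hτ, hμ, hz, ?_, ?_, ?_, hl, ?_⟩
    · simp
    · simp
    · simp; ring
    · rw [EReal.coe_eq_coe_iff]
      simp
      ring

lemma primalConicValue_le_dualValue (hX : IsCompact X) (hG : GeneratorLaws (cyl T X) C L)
    (hp : ContinuousOn p X) :
    primalConicValue T X C L p μ₀ r ≤ dualValue T X C L p μ₀ r := by
  refine sSup_le ?_
  rintro J ⟨μτ, μ, z, hτ, hμ, hz, e1, e2, e3, hl, rfl⟩
  refine le_sInf ?_
  rintro J ⟨v, w, h, rfl⟩
  rw [← dualFunction_of_feasible hX hG hp h]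
  refine le_sSup ⟨μτ, μ, z, hτ, hμ, hz, ?_⟩
  -- At a primal feasible point all multiplier terms vanish, so the Lagrangian is the primal
  -- objective.
  simp [lagrangian, e1, e2, e3, hl v h.mem_dom]

/-! ### Strong duality -/

/-- The cone of the dual program. -/
def dualCone (K : Set (ℝ × State n)) :
    PointedCone ℝ (C(K, ℝ) × C(K, ℝ) × (EuclideanSpace ℝ (Fin 3) × ℝ)) :=
  Submodule.prod (PointedCone.positive ℝ C(K, ℝ))
    (Submodule.prod (PointedCone.positive ℝ C(K, ℝ)) (socCone 3))

lemma mem_dualCone {K : Set (ℝ × State n)}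
    {x : C(K, ℝ) × C(K, ℝ) × (EuclideanSpace ℝ (Fin 3) × ℝ)} :
    x ∈ dualCone K ↔ 0 ≤ x.1 ∧ 0 ≤ x.2.1 ∧ x.2.2 ∈ secondOrderCone 3 := by
  simp [dualCone, Submodule.mem_prod, mem_socCone]

/-- The linear map of the dual program. -/
def dualMap (hG : GeneratorLaws (cyl T X) C L) (hp : ContinuousOn p X) :
    C × (Fin 3 → ℝ) →ₗ[ℝ]
      C(cyl T X, ℝ) × C(cyl T X, ℝ) × (EuclideanSpace ℝ (Fin 3) × ℝ) where
  toFun a :=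
    (restrictCont a.1.1 (hG.cont _ a.1.2)
        + a.2 0 • restrictCont _ ((continuousOn_cyl_snd T hp).pow 2)
        - (2 * a.2 1) • restrictCont _ (continuousOn_cyl_snd T hp),
      -- The constant entry `-r/2` of the cone constraint is moved to `dualRhs` with the opposite
      -- sign, which leaves `0` here.
      -restrictCont (L a.1.1) (hG.cont_gen _ a.1.2), (!₂[a.2 0 + a.2 2, 0, a.2 1], a.2 2))
  map_add' a b := by
    refine Prod.ext ?_ (Prod.ext ?_ (Prod.ext ?_ ?_))
    · ext x
      simp
      ring
    · ext x
      simp [hG.add _ a.1.2 _ b.1.2 x x.2]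
      ring
    · ext i
      fin_cases i <;> simp
      ring
    · simp
  map_smul' c a := by
    refine Prod.ext ?_ (Prod.ext ?_ (Prod.ext ?_ ?_))
    · ext x
      simp
      ring
    · ext x
      simp [hG.smul c _ a.1.2 x x.2]
    · ext i
      fin_cases i <;> simp
      ring
    · simp

/-- The right-hand side of the dual program. -/
def dualRhs (T : ℝ) (hp : ContinuousOn p X) (r : ℝ) :
    C(cyl T X, ℝ) × C(cyl T X, ℝ) × (EuclideanSpace ℝ (Fin 3) × ℝ) :=
  (restrictCont _ (continuousOn_cyl_snd T hp), 0, (!₂[0, r / 2, 0], 0))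

lemma integrable_initial (hT : 0 ≤ T) (hX : IsCompact X) (hG : GeneratorLaws (cyl T X) C L)
    (hμ₀ : IsMeasureOn X μ₀) {v : TestFun n} (hv : v ∈ C) :
    Integrable (fun x => v (0, x)) μ₀ :=
  integrable_of_continuousOn hX hμ₀
    ((hG.cont v hv).comp (by fun_prop) fun _ hx => ⟨⟨le_rfl, hT⟩, hx⟩)

/-- The cost of the dual program as a linear functional. -/
def dualCostL (hT : 0 ≤ T) (hX : IsCompact X) (hG : GeneratorLaws (cyl T X) C L)
    (hμ₀ : IsMeasureOn X μ₀) : C × (Fin 3 → ℝ) →ₗ[ℝ] ℝ where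
  toFun a := dualCost μ₀ a.1.1 a.2
  map_add' a b := by
    simp only [dualCost, Prod.fst_add, Prod.snd_add, Submodule.coe_add, Pi.add_apply]
    rw [integral_add (integrable_initial hT hX hG hμ₀ a.1.2)
      (integrable_initial hT hX hG hμ₀ b.1.2)]
    ring
  map_smul' c a := by
    simp only [dualCost, Prod.smul_fst, Prod.smul_snd, Submodule.coe_smul, Pi.smul_apply,
      smul_eq_mul, RingHom.id_apply]
    rw [integral_const_mul]
    ring

lemma dualFeasible_of_mem_dualCone (hG : GeneratorLaws (cyl T X) C L) (hp : ContinuousOn p X)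
    {a : C × (Fin 3 → ℝ)} (h : dualMap hG hp a - dualRhs T hp r ∈ dualCone (cyl T X)) :
    DualFeasible T X C L p r a.1.1 a.2 := by
  obtain ⟨h1, h2, h3⟩ := mem_dualCone.1 h
  refine ⟨a.1.2, fun t ht x hx => ?_, fun t ht x hx => ?_, ?_⟩
  · have := h2 ⟨(t, x), ht, hx⟩
    simpa [dualMap, dualRhs] using this
  · have := h1 ⟨(t, x), ht, hx⟩
    simpa [dualMap, dualRhs] using this
  · convert h3 using 1
    refine Prod.ext ?_ ?_
    · ext i
      fin_cases i <;> simp [dualMap, dualRhs]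
    · simp [dualMap, dualRhs]

/-- The dual program satisfies Slater's condition. -/
lemma exists_dualMap_add_mem (hX : IsCompact X) (hG : GeneratorLaws (cyl T X) C L)
    (hp : ContinuousOn p X) (y : C(cyl T X, ℝ) × C(cyl T X, ℝ) × (EuclideanSpace ℝ (Fin 3) × ℝ)) :
    ∃ a, dualMap hG hp a + y ∈ dualCone (cyl T X) := by
  have : CompactSpace (cyl T X) := isCompact_iff_compactSpace.1 (isCompact_cyl T hX)
  obtain ⟨φ, ψ, q⟩ := y
  -- With `u = (-k, 0, k)` the vector part `[u₁ + u₃, 0, u₂]` vanishes and `u₃ + q.2 = ‖q.1‖`, just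
  -- enough for the cone. With `v = ‖χ‖ - ‖ψ‖ t`, `-L v = ‖ψ‖` dominates `-ψ`, and the constant
  -- `‖χ‖` absorbs `χ`, the sum of all the other terms of the terminal constraint.
  set k : ℝ := ‖q.1‖ - q.2
  set one : C := ⟨fun _ => 1, hG.one_mem⟩
  set time : C := ⟨fun z => z.1, hG.time_mem⟩
  set χ : C(cyl T X, ℝ) := φ + (-k) • restrictCont _ ((continuousOn_cyl_snd T hp).pow 2)
    - ‖ψ‖ • restrictCont _ (hG.cont _ hG.time_mem) with hχ
  have hgen : ∀ z ∈ cyl T X, L (‖χ‖ • one.1 + (-‖ψ‖) • time.1) z = -‖ψ‖ := fun z hz => by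
    rw [hG.add _ (C.smul_mem _ one.2) _ (C.smul_mem _ time.2) z hz, hG.smul _ _ one.2 z hz,
      hG.smul _ _ time.2 z hz, hG.gen_one z hz, hG.gen_time z hz]
    ring
  refine ⟨(‖χ‖ • one + (-‖ψ‖) • time, ![-k, 0, k]), mem_dualCone.2 ⟨fun z => ?_, fun z => ?_, ?_⟩⟩
  · have h1 := (abs_le.1 (χ.norm_coe_le_norm z)).1
    have h2 : χ z = φ z - k * p z.1.2 ^ 2 - ‖ψ‖ * z.1.1 := by simp [hχ]; ring
    simp [dualMap, one, time]
    linarith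
  · have h1 := (abs_le.1 (ψ.norm_coe_le_norm z)).1
    have h2 := hgen z z.2
    change 0 ≤ -L (‖χ‖ • one.1 + (-‖ψ‖) • time.1) z + ψ z
    rw [h2]
    linarith
  · have h : (!₂[-k + k, 0, 0] : EuclideanSpace ℝ (Fin 3)) = 0 := by
      ext i
      fin_cases i <;> simp
    change ‖!₂[-k + k, 0, 0] + q.1‖ ≤ k + q.2
    rw [h, zero_add]
    simp [k]

/-- The multiplier of the dual program, decoded componentwise, is a primal feasible point of value
at least `d`. Taking real `d` strictly below the dual value also covers infinite values. -/
lemma dualValue_le_primalConicValue (hT : 0 ≤ T) (hX : IsCompact X)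
    (hG : GeneratorLaws (cyl T X) C L) (hp : ContinuousOn p X) (hμ₀ : IsMeasureOn X μ₀) :
    dualValue T X C L p μ₀ r ≤ primalConicValue T X C L p μ₀ r := by
  rw [← EReal.ge_of_forall_gt_iff_ge]
  intro d hd
  have hK := isCompact_cyl T hX
  obtain ⟨g, hg, hg0, hgd⟩ := exists_conic_multiplier (dualCone (cyl T X)) (dualMap hG hp)
    (dualCostL hT hX hG hμ₀) (dualRhs T hp r) d
    (fun a ha => by
      have := hd.le.trans (sInf_le ⟨a.1.1, a.2, dualFeasible_of_mem_dualCone hG hp ha, rfl⟩)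
      exact EReal.coe_le_coe_iff.1 this)
    (exists_dualMap_add_mem hX hG hp)
  obtain ⟨μτ, hτ, hτg⟩ := exists_measure_of_nonneg hK (g ∘ₗ LinearMap.inl ℝ _ _) fun φ hφ =>
    hg0 _ (mem_dualCone.2 ⟨hφ, le_rfl, (socCone 3).zero_mem⟩)
  obtain ⟨μ, hμ, hμg⟩ := exists_measure_of_nonneg hK
    (g ∘ₗ LinearMap.inr ℝ _ _ ∘ₗ LinearMap.inl ℝ _ _) fun φ hφ =>
    hg0 _ (mem_dualCone.2 ⟨le_rfl, hφ, (socCone 3).zero_mem⟩)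
  obtain ⟨z, hz, hzg⟩ := exists_socPairing_eq
    (g ∘ₗ LinearMap.inr ℝ _ _ ∘ₗ LinearMap.inr ℝ _ _) fun x hx =>
    hg0 _ (mem_dualCone.2 ⟨le_rfl, le_rfl, hx⟩)
  have hsplit : ∀ φ ψ q, g (φ, ψ, q) = g (φ, 0, 0) + g (0, ψ, 0) + g (0, 0, q) := by
    intro φ ψ q
    rw [← map_add, ← map_add]
    simp
  simp only [LinearMap.comp_apply, LinearMap.inl_apply, LinearMap.inr_apply] at hμg hzg
  replace hτg : ∀ (h : ℝ × State n → ℝ) (hh : ContinuousOn h (cyl T X)),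
      g (restrictCont h hh, 0, 0) = ∫ x, h x ∂μτ := hτg
  have hpK := continuousOn_cyl_snd T hp
  -- The identity between `g` composed with the constraint map and the dual cost, in terms of `μτ`,
  -- `μ` and `z`. Being valid for all `v` and `w`, it contains every primal equation.
  have main : ∀ v (hv : v ∈ C) (w : Fin 3 → ℝ),
      (∫ y, v y ∂μτ) + w 0 * secondMoment p μτ - 2 * w 1 * mean p μτ - (∫ y, L v y ∂μ)
        + (z.1 0 * (w 0 + w 2) + z.1 2 * w 1 + z.2 * w 2) = dualCost μ₀ v w := by
    intro v hv w
    have h1 : g (restrictCont v (hG.cont v hv) + w 0 • restrictCont _ (hpK.pow 2)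
        - (2 * w 1) • restrictCont _ hpK, -restrictCont (L v) (hG.cont_gen v hv),
        (!₂[w 0 + w 2, 0, w 1], w 2)) = dualCost μ₀ v w := hg (⟨v, hv⟩, w)
    rw [hsplit, hzg] at h1
    have e1 : ∀ (φ φ' φ'' : C(cyl T X, ℝ)) (a b : ℝ),
        g (φ + a • φ' - b • φ'', 0, 0) = g (φ, 0, 0) + a * g (φ', 0, 0) - b * g (φ'', 0, 0) := by
      intro φ φ' φ'' a b
      rw [← smul_eq_mul, ← smul_eq_mul, ← map_smul, ← map_smul, ← map_add, ← map_sub]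
      congr 1
      simp
    have e2 : ∀ φ : C(cyl T X, ℝ), g (0, -φ, 0) = -g (0, φ, 0) := by
      intro φ
      rw [← map_neg]
      simp
    rw [e1, e2, hτg, hτg, hτg, hμg] at h1
    rw [← h1]
    simp only [socPairing, mean, secondMoment, PiLp.inner_apply, Fin.sum_univ_three]
    simp
    ring
  have hrhs : g (dualRhs T hp r) = r / 2 * z.1 1 + mean p μτ := by
    rw [dualRhs, hsplit, hτg, hzg, hzg]
    simp only [socPairing, mean, PiLp.inner_apply, Fin.sum_univ_three]
    simp
    ring
  -- Subtracting the case `w = 0` cancels the term `∫ L 0 ∂μ`, so no separate evaluation of `L 0` is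
  -- needed. The unit vectors `w` then give the three scalar equations.
  have hzero : ∀ w : Fin 3 → ℝ, w 0 * secondMoment p μτ - 2 * w 1 * mean p μτ
      + (z.1 0 * (w 0 + w 2) + z.1 2 * w 1 + z.2 * w 2) = w 0 + 2 * w 2 := by
    intro w
    have h1 := main 0 C.zero_mem w
    have h2 := main 0 C.zero_mem 0
    simp [dualCost] at h1 h2
    linarith
  refine (EReal.coe_le_coe_iff.2 hgd).trans (le_sSup ⟨μτ, μ, z, hτ, hμ, hz, ?_, ?_, ?_, ?_, ?_⟩)
  · have := hzero ![1, 0, 0]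
    simp at this
    linarith
  · have := hzero ![0, 1, 0]
    simp at this
    linarith
  · have := hzero ![0, 0, 1]
    simp at this
    linarith
  · intro v hv
    have := main v hv 0
    simp [dualCost] at this
    linarith
  · rw [hrhs]

end Programs

end ChancePeak

end

theorem mainTheorem3 {n : ℕ} (T : ℝ) (hT : 0 ≤ T)
    (X : Set (ChancePeak.State n)) (hX : IsCompact X)
    (C : Submodule ℝ (ChancePeak.TestFun n))
    (L : ChancePeak.TestFun n → ChancePeak.TestFun n)
    (hL : ChancePeak.IsGenerator.{u} T X C L)
    (p : ChancePeak.State n → ℝ) (hp : ContinuousOn p X)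
    (μ₀ : MeasureTheory.Measure (ChancePeak.State n)) (hμ₀ : ChancePeak.IsMeasureOn X μ₀)
    (r : ℝ) :
    -- the program is the Lagrangian dual of the measure program
    (ChancePeak.primalConicValue T X C L p μ₀ r = ChancePeak.primalValue T X C L p μ₀ r ∧
      (∀ v ∈ C, ∀ w : Fin 3 → ℝ,
        (ChancePeak.DualFeasible T X C L p r v w →
          ChancePeak.dualFunction T X L p μ₀ r v w = (ChancePeak.dualCost μ₀ v w : EReal)) ∧
        (¬ ChancePeak.DualFeasible T X C L p r v w →
          ChancePeak.dualFunction T X L p μ₀ r v w = ⊤)) ∧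
      ChancePeak.lagrangianDualValue T X C L p μ₀ r =
        ChancePeak.dualValue T X C L p μ₀ r) ∧
    -- weak duality
    ChancePeak.primalValue T X C L p μ₀ r ≤ ChancePeak.dualValue T X C L p μ₀ r ∧
    -- strong duality
    (μ₀ Set.univ = 1 →
      ChancePeak.dualValue T X C L p μ₀ r = ChancePeak.primalValue T X C L p μ₀ r) := by
  have hG := hL.laws hX
  have hweak : ChancePeak.primalValue T X C L p μ₀ r ≤ ChancePeak.dualValue T X C L p μ₀ r :=
    ChancePeak.primalConicValue_eq (T := T) ▸ ChancePeak.primalConicValue_le_dualValue hX hG hp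
  have hstrong : ChancePeak.dualValue T X C L p μ₀ r ≤ ChancePeak.primalValue T X C L p μ₀ r :=
    ChancePeak.primalConicValue_eq (T := T) ▸
      ChancePeak.dualValue_le_primalConicValue hT hX hG hp hμ₀
  exact ⟨⟨ChancePeak.primalConicValue_eq,
    fun v hv w => ⟨ChancePeak.dualFunction_of_feasible hX hG hp,
      ChancePeak.dualFunction_of_not_feasible hX hG hp hv⟩,
    ChancePeak.lagrangianDualValue_eq hX hG hp⟩, hweak, fun _ => le_antisymm hstrong hweak⟩
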